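/- Let $\gamma$ be the golden mean, in either of its usual forms $\gamma=\frac{1+\sqrt5}{2}$ or $\gamma=\frac{\sqrt5-1}{2}$, and let the rotation angle be $\alpha=\gamma$ (angle measured in radians) or $\alpha=2\pi\gamma$ (angle measured in full turns). For $n\ge 0$ let $B_n$ be the $n\times n$ complex matrix with entries $B_{km}=e^{i(km\alpha+m\beta)}$, $0\le k,m\le n-1$, with $\beta=0$, that is, $B_{km}=e^{ikm\alpha}$; it is the Vandermonde matrix of the numbers $z^k$, $z=e^{i\alpha}$. Put $f_r(z)=\prod_{k=1}^{r}(1-z^k)$. Then: 1. $|\det B_n|=\prod_{r=1}^{n-1}|f_r(z)|$ for every $n$, and if $\alpha=2\pi\gamma$ this is non-zero for every $n$; 2. for every $n$, $|\det B_n|\le 2^n\,n!$, equivalently $\log|\det B_n|\le\log(2^n\,n!)$ (with $\log 0=-\infty$); 3. the bound $\log(2^n\,n!)$ is asymptotically equivalent to $n\log n$ as $n\to\infty$; consequently, for every $\varepsilon>0$, $\log|\det B_n|\le(1+\varepsilon)\,n\log n$ for all sufficiently large $n$. -/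

import Mathlib

/-- The `n × n` matrix with entries `B_{km} = exp(i (k m α + m β))`, `0 ≤ k, m < n`; it is the
Vandermonde matrix `(z ^ k * w) ^ m` with `z = exp(i α)` and `w = exp(i β)`. -/
noncomputable def rotationVandermonde (n : ℕ) (α β : ℝ) : Matrix (Fin n) (Fin n) ℂ :=
  Matrix.of fun k m =>
    Complex.exp (Complex.I * (((k : ℕ) : ℂ) * ((m : ℕ) : ℂ) * (α : ℂ) + ((m : ℕ) : ℂ) * (β : ℂ)))

/-- The Sudler-type product `f_r(z) = ∏_{k=1}^{r} (1 - z ^ k)`. -/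
noncomputable def sudlerProd (r : ℕ) (z : ℂ) : ℂ :=
  ∏ k ∈ Finset.Icc 1 r, (1 - z ^ k)

/-! Removing node `z ^ 0` from the Vandermonde product of size `n + 1` splits off `|f_n(z)|`; since
`|z| = 1`, the other nodes have the mutual distances of the size-`n` case, so induction applies. For
`α = 2πγ`, irrationality of `γ` keeps `z` from being a root of unity, so no factor vanishes. The
upper bound needs only unimodular entries: Leibniz's formula has `n!` terms of modulus 1, and `2 ^
n` is slack. Finally `n ^ n / n! ≤ e ^ n` gives `log n! = n log n + O(n)`, and `2 ^ n` contributes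
only `O(n)`. -/

/-- The rotation matrix with `β = 0` is the Vandermonde matrix of the powers of `exp (i α)`. -/
theorem rotationVandermonde_zero_eq (n : ℕ) (α : ℝ) :
    rotationVandermonde n α 0 =
      Matrix.vandermonde fun k : Fin n => Complex.exp (Complex.I * (α : ℂ)) ^ (k : ℕ) := by
  ext k m
  simp only [rotationVandermonde, Matrix.of_apply, Matrix.vandermonde_apply, ← Complex.exp_nat_mul]
  congr 1
  push_cast
  ring

theorem norm_exp_I_mul_ofReal (α : ℝ) : ‖Complex.exp (Complex.I * (α : ℂ))‖ = 1 := by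
  rw [mul_comm]
  exact Complex.norm_exp_ofReal_mul_I α

/-- The Vandermonde determinant of the powers of a unimodular number, as a product of
Sudler products. -/
theorem norm_det_vandermonde_pow {z : ℂ} (hz : ‖z‖ = 1) (n : ℕ) :
    ‖(Matrix.vandermonde fun k : Fin n => z ^ (k : ℕ)).det‖ =
      ∏ r ∈ Finset.Ico 1 n, ‖sudlerProd r z‖ := by
  simp only [Matrix.det_vandermonde, norm_prod]
  induction n with
  | zero => simp
  | succ n ih =>
    have hshift (i j : Fin n) : ‖z ^ (j.succ : ℕ) - z ^ (i.succ : ℕ)‖ =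
        ‖z ^ (j : ℕ) - z ^ (i : ℕ)‖ := by
      simp only [Fin.val_succ, pow_succ, ← sub_mul, norm_mul, hz, mul_one]
    have hfirst : ∏ j : Fin n, ‖z ^ (j.succ : ℕ) - z ^ ((0 : Fin (n + 1)) : ℕ)‖ =
        ‖sudlerProd n z‖ := by
      rw [sudlerProd, norm_prod, ← Finset.Ico_add_one_right_eq_Icc, Finset.prod_Ico_eq_prod_range,
        ← Fin.prod_univ_eq_prod_range]
      refine Finset.prod_congr rfl fun j _ => ?_
      rw [norm_sub_rev, Fin.val_succ, add_comm 1 (j : ℕ)]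
      simp
    rw [Fin.prod_univ_succ, Fin.prod_Ioi_zero, hfirst]
    simp only [Fin.prod_Ioi_succ, hshift, ih]
    -- For `n = 0` the range `Ico 1 1` has no top factor to split off; there `f_0 = 1`.
    rcases Nat.eq_zero_or_pos n with rfl | hn
    · simp [sudlerProd]
    · rw [Finset.prod_Ico_succ_top hn, mul_comm]

theorem exp_two_pi_mul_irrational_pow_ne_one {γ : ℝ} (hγ : Irrational γ) {k : ℕ} (hk : k ≠ 0) :
    Complex.exp (Complex.I * ((2 * Real.pi * γ : ℝ) : ℂ)) ^ k ≠ 1 := by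
  rw [← Complex.exp_nat_mul, Ne, Complex.exp_eq_one_iff]
  rintro ⟨m, hm⟩
  have h : (((k : ℝ) * γ : ℝ) : ℂ) = ((m : ℝ) : ℂ) := by
    apply mul_right_cancel₀ Complex.two_pi_I_ne_zero
    push_cast at hm ⊢
    linear_combination hm
  exact (hγ.natCast_mul hk).ne_int m (Complex.ofReal_injective h)

theorem sudlerProd_ne_zero {γ : ℝ} (hγ : Irrational γ) (r : ℕ) :
    sudlerProd r (Complex.exp (Complex.I * ((2 * Real.pi * γ : ℝ) : ℂ))) ≠ 0 := by
  refine Finset.prod_ne_zero_iff.mpr fun k hk => sub_ne_zero.mpr (Ne.symm ?_)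
  have := (Finset.mem_Icc.mp hk).1
  exact exp_two_pi_mul_irrational_pow_ne_one hγ (by omega)

theorem norm_det_rotationVandermonde_le_factorial (n : ℕ) (α β : ℝ) :
    ‖(rotationVandermonde n α β).det‖ ≤ n.factorial := by
  have hentry (k m : Fin n) : ‖rotationVandermonde n α β k m‖ ≤ 1 := by
    have h := norm_exp_I_mul_ofReal (((k : ℕ) : ℝ) * ((m : ℕ) : ℝ) * α + ((m : ℕ) : ℝ) * β)
    push_cast at h
    exact h.le
  have h := Matrix.det_le (abv := NormedField.toAbsoluteValue ℂ) hentry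
  simp only [Fintype.card_fin, one_pow, nsmul_one] at h
  exact h

theorem norm_det_rotationVandermonde_le (n : ℕ) (α β : ℝ) :
    ‖(rotationVandermonde n α β).det‖ ≤ (2 : ℝ) ^ n * (n.factorial : ℝ) :=
  (norm_det_rotationVandermonde_le_factorial n α β).trans
    (le_mul_of_one_le_left (by positivity) (one_le_pow₀ one_le_two))

theorem log_norm_det_rotationVandermonde_le (n : ℕ) (α β : ℝ) :
    Real.log ‖(rotationVandermonde n α β).det‖ ≤ Real.log ((2 : ℝ) ^ n * (n.factorial : ℝ)) := by
  rcases (norm_nonneg (rotationVandermonde n α β).det).eq_or_lt with h | h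
  -- `Real.log 0 = 0` rather than `-∞`, so a vanishing determinant requires the right side to be
  -- nonnegative.
  · rw [← h, Real.log_zero]
    refine Real.log_nonneg (one_le_mul_of_one_le_of_one_le (one_le_pow₀ one_le_two) ?_)
    exact_mod_cast n.factorial_pos
  · exact Real.log_le_log h (norm_det_rotationVandermonde_le n α β)

theorem abs_log_two_pow_mul_factorial_sub_le {n : ℕ} (hn : n ≠ 0) :
    |Real.log ((2 : ℝ) ^ n * (n.factorial : ℝ)) - n * Real.log n| ≤ n := by
  have hn' : (0 : ℝ) < n := by positivity
  have hf : (0 : ℝ) < n.factorial := by positivity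
  have hlower : n * Real.log n - n ≤ Real.log n.factorial := by
    have h := Real.log_le_log (by positivity) (Real.pow_div_factorial_le_exp _ hn'.le n)
    rw [Real.log_exp, Real.log_div (by positivity) hf.ne', Real.log_pow] at h
    linarith
  have hupper : Real.log n.factorial ≤ n * Real.log n := by
    rw [← Real.log_pow]
    exact Real.log_le_log hf (by exact_mod_cast n.factorial_le_pow)
  -- The difference lies between `n log 2 - n` and `n log 2`, hence the constant 1.
  have h2 : Real.log 2 ≤ 1 := by linarith [Real.log_two_lt_d9]
  have h2' : 0 ≤ Real.log 2 := Real.log_nonneg one_le_two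
  rw [Real.log_mul (by positivity) hf.ne', Real.log_pow, abs_le]
  constructor <;> nlinarith

theorem log_two_pow_mul_factorial_isEquivalent :
    Asymptotics.IsEquivalent Filter.atTop
      (fun n : ℕ => Real.log ((2 : ℝ) ^ n * (n.factorial : ℝ)))
      (fun n : ℕ => (n : ℝ) * Real.log (n : ℝ)) := by
  have hbig : (fun n : ℕ => Real.log ((2 : ℝ) ^ n * (n.factorial : ℝ)) - n * Real.log n)
      =O[Filter.atTop] fun n : ℕ => (n : ℝ) := by
    refine Asymptotics.IsBigO.of_bound 1 ?_
    filter_upwards [Filter.eventually_ne_atTop 0] with n hn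
    simpa using abs_log_two_pow_mul_factorial_sub_le hn
  have hlittle : (fun n : ℕ => (n : ℝ)) =o[Filter.atTop] fun n : ℕ => (n : ℝ) * Real.log n := by
    have h := (Asymptotics.isBigO_refl (fun n : ℕ => (n : ℝ)) Filter.atTop).mul_isLittleO
      ((Asymptotics.isLittleO_const_left (c := (1 : ℝ))).mpr (Or.inr
        (Filter.tendsto_abs_atTop_atTop.comp
          (Real.tendsto_log_atTop.comp tendsto_natCast_atTop_atTop))))
    simpa using h
  exact hbig.trans_isLittleO hlittle

theorem mainTheorem6 (γ α : ℝ)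
    (hγ : γ = Real.goldenRatio ∨ γ = Real.goldenRatio⁻¹)
    (hα : α = γ ∨ α = 2 * Real.pi * γ) :
    (∀ n : ℕ,
      ‖(rotationVandermonde n α 0).det‖ =
        ∏ r ∈ Finset.Ico 1 n, ‖sudlerProd r (Complex.exp (Complex.I * (α : ℂ)))‖) ∧
    (α = 2 * Real.pi * γ → ∀ n : ℕ, (rotationVandermonde n α 0).det ≠ 0) ∧
    (∀ n : ℕ, ‖(rotationVandermonde n α 0).det‖ ≤ (2 : ℝ) ^ n * (n.factorial : ℝ)) ∧
    (∀ n : ℕ, Real.log ‖(rotationVandermonde n α 0).det‖ ≤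
      Real.log ((2 : ℝ) ^ n * (n.factorial : ℝ))) ∧
    Asymptotics.IsEquivalent Filter.atTop
      (fun n : ℕ => Real.log ((2 : ℝ) ^ n * (n.factorial : ℝ)))
      (fun n : ℕ => (n : ℝ) * Real.log (n : ℝ)) ∧
    (∀ ε : ℝ, 0 < ε → ∀ᶠ n : ℕ in Filter.atTop,
      Real.log ‖(rotationVandermonde n α 0).det‖ ≤ (1 + ε) * ((n : ℝ) * Real.log (n : ℝ))) := by
  have hdet (n : ℕ) : ‖(rotationVandermonde n α 0).det‖ =
      ∏ r ∈ Finset.Ico 1 n, ‖sudlerProd r (Complex.exp (Complex.I * (α : ℂ)))‖ := by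
    rw [rotationVandermonde_zero_eq, norm_det_vandermonde_pow (norm_exp_I_mul_ofReal α)]
  have hirr : Irrational γ := by
    rcases hγ with rfl | rfl
    · exact Real.goldenRatio_irrational
    · exact Real.goldenRatio_irrational.inv
  refine ⟨hdet, ?_, fun n => norm_det_rotationVandermonde_le n α 0,
    fun n => log_norm_det_rotationVandermonde_le n α 0,
    log_two_pow_mul_factorial_isEquivalent, ?_⟩
  · rintro rfl n
    rw [← norm_ne_zero_iff, hdet]
    exact Finset.prod_ne_zero_iff.mpr fun r _ => norm_ne_zero_iff.mpr (sudlerProd_ne_zero hirr r)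
  · intro ε hε
    filter_upwards [log_two_pow_mul_factorial_isEquivalent.isLittleO.bound hε] with n hn
    have hnonneg : 0 ≤ (n : ℝ) * Real.log n := mul_nonneg n.cast_nonneg (Real.log_natCast_nonneg n)
    rw [Pi.sub_apply, Real.norm_eq_abs, Real.norm_of_nonneg hnonneg] at hn
    linarith [le_of_abs_le hn, log_norm_det_rotationVandermonde_le n α 0]
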